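/- Let $A$ be a left Artin ring and let $\operatorname{proj} A$ be the category of finitely generated projective left $A$-modules. Complexes are written homologically, $\cdots\to C_{n+1}\to C_n\to C_{n-1}\to\cdots$, and subcategories of the homotopy category $\mathbf{K}(\operatorname{proj} A)$ of complexes in $\operatorname{proj} A$ are taken up to isomorphism. A complex $C$ is totally acyclic if $\operatorname{Hom}_A(P,C)$ and $\operatorname{Hom}_A(C,P)$ are acyclic for all $P\in\operatorname{proj} A$; it is eventually acyclic if for every $P\in\operatorname{proj} A$ one has $H_n(\operatorname{Hom}_A(P,C))=0$ for $|n|\gg 0$. Let $\mathbf{K}_{\mathrm{tac}}(\operatorname{proj} A)$ be the full subcategory of $\mathbf{K}(\operatorname{proj} A)$ of totally acyclic complexes, $\mathbf{K}^{-,\mathrm{b}}(\operatorname{proj} A)$ that of eventually acyclic complexes $C$ with $C_n=0$ for $n\ll 0$, and $\mathbf{K}^{\mathrm{b}}(\operatorname{proj} A)$ that of complexes with $C_n=0$ for $|n|\gg 0$. Let $\mathbf{D}^{\mathrm{b}}_{\mathrm{st}}(A)=\mathbf{K}^{-,\mathrm{b}}(\operatorname{proj} A)/\mathbf{K}^{\mathrm{b}}(\operatorname{proj}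 A)$ be the Verdier quotient, and let $$\beta_{\operatorname{proj} A}\colon \mathbf{K}_{\mathrm{tac}}(\operatorname{proj} A)\to \mathbf{D}^{\mathrm{b}}_{\mathrm{st}}(A)$$ be the functor induced by brutal truncation at degree zero, sending $C$ to the complex $\cdots\to C_2\to C_1\to C_0\to 0\to\cdots$ and the class of a chain map to the class of its truncation. If $\beta_{\operatorname{proj} A}$ is dense (that is, every object of $\mathbf{D}^{\mathrm{b}}_{\mathrm{st}}(A)$ is isomorphic to an object in its image), then the injective dimension of $A$ as a left $A$-module is finite. -/

import Mathlib

universe v u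

namespace StableDerived

noncomputable section

open CategoryTheory CategoryTheory.Limits ZeroObject

/-!
Conventions: complexes are indexed cohomologically, `Cⁿ = C_{-n}`.  So `C_n = 0` for `n ≪ 0`
(homological) reads `C.X n = 0` for `n ≫ 0`, the suspension is the shift functor `⟦1⟧` of Mathlib,
and the brutal truncation `β_{≥ 0}(C)` keeps the terms `C.X n` with `n ≤ 0`.
-/

section Complexes

variable {V : Type u} [Category.{v} V] [Preadditive V]

/-- The complex of abelian groups `Hom(P, C)`. -/
abbrev homTo (P : V) (C : CochainComplex V ℤ) : CochainComplex AddCommGrpCat.{v} ℤ :=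
  ((preadditiveCoyoneda.obj (Opposite.op P)).mapHomologicalComplex (ComplexShape.up ℤ)).obj C

/-- The complex of abelian groups `Hom(C, P)`; its differentials lower the index. -/
abbrev homFrom (C : CochainComplex V ℤ) (P : V) :
    HomologicalComplex AddCommGrpCat.{v} (ComplexShape.up ℤ).symm :=
  ((preadditiveYoneda.obj P).mapHomologicalComplex (ComplexShape.up ℤ).symm).obj
    (HomologicalComplex.op C)

/-- `C` is acyclic: `Hom(P, C)` is acyclic for all objects `P`. -/
def IsAcyclic (C : CochainComplex V ℤ) : Prop :=
  ∀ P : V, (homTo P C).Acyclic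

/-- `C` is totally acyclic: acyclic, and `Hom(C, P)` is acyclic for all objects `P`. -/
def IsTotallyAcyclic (C : CochainComplex V ℤ) : Prop :=
  IsAcyclic C ∧ ∀ P : V, (homFrom C P).Acyclic

/-- `C` is eventually acyclic: for each `P`, the homology of `Hom(P, C)` vanishes in all degrees
of large absolute value (how large may depend on `P`). -/
def IsEventuallyAcyclic (C : CochainComplex V ℤ) : Prop :=
  ∀ P : V, ∃ N : ℤ, ∀ n : ℤ, N < |n| → (homTo P C).ExactAt n

end Complexes

section Subcategories

variable (V : Type u) [Category.{v} V] [Preadditive V]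

/-- The homotopy category of complexes in `V`. -/
abbrev K := HomotopyCategory V (ComplexShape.up ℤ)

/-- The totally acyclic complexes.  (Total acyclicity is invariant under homotopy equivalence, so
no closure under isomorphisms is needed here.) -/
def totallyAcyclic : ObjectProperty (K V) := fun X => IsTotallyAcyclic X.as

/-- The eventually acyclic complexes. -/
def eventuallyAcyclic : ObjectProperty (K V) := fun X => IsEventuallyAcyclic X.as

/-- Complexes with `C.X n = 0` for `n ≫ 0` (homologically: `C_n = 0` for `n ≪ 0`). -/
def rightBounded : ObjectProperty (K V) :=
  fun X => ∃ N : ℤ, ∀ n : ℤ, N < n → IsZero (X.as.X n)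

/-- Complexes with `C.X n = 0` for `|n| ≫ 0`. -/
def bounded : ObjectProperty (K V) :=
  fun X => ∃ N : ℤ, ∀ n : ℤ, N < |n| → IsZero (X.as.X n)

/-- The objects of `K^{-,b}`: right bounded (up to isomorphism) and eventually acyclic. -/
def minusB : ObjectProperty (K V) := (rightBounded V).isoClosure ⊓ eventuallyAcyclic V

/-- The category of totally acyclic complexes, a full subcategory of the homotopy category. -/
abbrev Ktac := (totallyAcyclic V).FullSubcategory

/-- The category `K^{-,b}` of right bounded, eventually acyclic complexes. -/
abbrev KMinusB := (minusB V).FullSubcategory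

/-- The objects of `K^b` (complexes isomorphic in the homotopy category to a bounded one), as a
property of objects of `K^{-,b}`. -/
abbrev perf : ObjectProperty (KMinusB V) := (bounded V).isoClosure.inverseImage (minusB V).ι

end Subcategories

section Triangulated

variable (V : Type u) [Category.{v} V] [Preadditive V]

/-- The functor `C ↦ Hⁿ(Hom(P, C))` on the homotopy category. -/
abbrev homologyHomTo (P : V) (n : ℤ) : K V ⥤ AddCommGrpCat.{v} :=
  (preadditiveCoyoneda.obj (Opposite.op P)).mapHomotopyCategory (ComplexShape.up ℤ) ⋙
    HomotopyCategory.homologyFunctor AddCommGrpCat.{v} (ComplexShape.up ℤ) n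

variable {V} in
lemma exactAt_homTo_iff (P : V) (n : ℤ) (X : K V) :
    (homTo P X.as).ExactAt n ↔ IsZero ((homologyHomTo V P n).obj X) := by
  rw [HomologicalComplex.exactAt_iff_isZero_homology]
  exact ((HomotopyCategory.homologyFunctorFactors AddCommGrpCat.{v} (ComplexShape.up ℤ) n).app
    (homTo P X.as)).symm.isZero_iff

instance : (eventuallyAcyclic V).IsClosedUnderIsomorphisms where
  of_iso {X Y} e h P := by
    obtain ⟨N, hN⟩ := h P
    refine ⟨N, fun n hn => ?_⟩
    rw [exactAt_homTo_iff]
    exact ((exactAt_homTo_iff P n X).1 (hN n hn)).of_iso ((homologyHomTo V P n).mapIso e.symm)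

instance : (eventuallyAcyclic V).IsStableUnderShift ℤ where
  isStableUnderShiftBy a :=
    { le_shift := fun X h P => by
        obtain ⟨N, hN⟩ := h P
        refine ⟨N + |a|, fun n hn => ?_⟩
        rw [exactAt_homTo_iff]
        have h1 := (exactAt_homTo_iff P (a + n) X).1 (hN (a + n) (by
          have := abs_sub_abs_le_abs_sub n (-a)
          rw [abs_neg, sub_neg_eq_add, add_comm n a] at this
          linarith))
        refine h1.of_iso ?_
        exact (HomotopyCategory.homologyFunctor AddCommGrpCat.{v} (ComplexShape.up ℤ) n).mapIso
            ((((preadditiveCoyoneda.obj (Opposite.op P)).mapHomotopyCategory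
              (ComplexShape.up ℤ)).commShiftIso a).app X) ≪≫
          ((HomotopyCategory.homologyFunctor AddCommGrpCat.{v} (ComplexShape.up ℤ) 0).shiftIso
            a n (a + n) rfl).app _ }

variable [HasZeroObject V]

instance : (eventuallyAcyclic V).ContainsZero where
  exists_zero := ⟨(HomotopyCategory.quotient _ _).obj 0, Functor.map_isZero _ (isZero_zero _),
    fun P => ⟨0, fun n _ => by
      rw [exactAt_homTo_iff P n ((HomotopyCategory.quotient _ _).obj 0)]
      exact Functor.map_isZero _ (Functor.map_isZero _ (isZero_zero _))⟩⟩

instance : (rightBounded V).ContainsZero where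
  exists_zero := ⟨(HomotopyCategory.quotient _ _).obj 0, Functor.map_isZero _ (isZero_zero _),
    ⟨0, fun n _ => (HomologicalComplex.eval V _ n).map_isZero (isZero_zero _)⟩⟩

instance : (bounded V).ContainsZero where
  exists_zero := ⟨(HomotopyCategory.quotient _ _).obj 0, Functor.map_isZero _ (isZero_zero _),
    ⟨0, fun n _ => (HomologicalComplex.eval V _ n).map_isZero (isZero_zero _)⟩⟩

instance : (rightBounded V).IsStableUnderShift ℤ where
  isStableUnderShiftBy a :=
    { le_shift := fun X h => by
        obtain ⟨C, rfl⟩ := X.quotient_obj_surjective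
        obtain ⟨N, hN⟩ := h
        rw [ObjectProperty.prop_shift_iff, HomotopyCategory.shift_quotient_obj]
        exact ⟨N - a, fun n hn => hN (n + a) (by linarith)⟩ }

instance : (bounded V).IsStableUnderShift ℤ where
  isStableUnderShiftBy a :=
    { le_shift := fun X h => by
        obtain ⟨C, rfl⟩ := X.quotient_obj_surjective
        obtain ⟨N, hN⟩ := h
        rw [ObjectProperty.prop_shift_iff, HomotopyCategory.shift_quotient_obj]
        exact ⟨N + |a|, fun n hn => hN (n + a) (by
          have := abs_sub_abs_le_abs_sub n (-a)
          rw [abs_neg, sub_neg_eq_add] at this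
          linarith)⟩ }

variable [HasBinaryBiproducts V]

variable {V} in
lemma cone_isoClosure (Φ : ObjectProperty (K V))
    (hΦ : ∀ {C D : CochainComplex V ℤ} (f : C ⟶ D), Φ ((HomotopyCategory.quotient _ _).obj C) →
      Φ ((HomotopyCategory.quotient _ _).obj D) →
      Φ ((HomotopyCategory.quotient _ _).obj (CochainComplex.mappingCone f))) :
    Φ.IsTriangulatedClosed₃ where
  ext₃' T hT h₁ h₂ := by
    obtain ⟨f : T.obj₁.as ⟶ T.obj₂.as, hf⟩ :=
      (HomotopyCategory.quotient _ _).map_surjective T.mor₁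
    refine ⟨_, hΦ f h₁ h₂, ⟨Pretriangulated.Triangle.π₃.mapIso
      (Pretriangulated.isoTriangleOfIso₁₂ T _ hT
        (HomotopyCategory.mappingCone_triangleh_distinguished f)
        (Iso.refl _) (Iso.refl _) ?_)⟩⟩
    exact (Category.comp_id _).trans (hf.symm.trans (Category.id_comp _).symm)

instance : (rightBounded V).IsTriangulatedClosed₃ :=
  cone_isoClosure _ fun f ⟨N, hN⟩ ⟨M, hM⟩ => ⟨max N M, fun n hn =>
    (CochainComplex.mappingCone.isZero_X_iff f n).2
      ⟨hN _ (by have := le_max_left N M; linarith), hM _ (by have := le_max_right N M; linarith)⟩⟩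

instance : (bounded V).IsTriangulatedClosed₃ :=
  cone_isoClosure _ fun f ⟨N, hN⟩ ⟨M, hM⟩ => ⟨max N M + 1, fun n hn =>
    (CochainComplex.mappingCone.isZero_X_iff f n).2
      ⟨hN _ (by
        have h1 := le_max_left N M
        have h2 := abs_sub_abs_le_abs_sub n (-1)
        rw [abs_neg, sub_neg_eq_add, abs_one] at h2
        linarith), hM _ (by have := le_max_right N M; linarith)⟩⟩

instance : (rightBounded V).IsTriangulated where
  toIsTriangulatedClosed₂ := .of_isTriangulatedClosed₃

instance : (bounded V).IsTriangulated where
  toIsTriangulatedClosed₂ := .of_isTriangulatedClosed₃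

instance : (eventuallyAcyclic V).IsTriangulated where
  toIsTriangulatedClosed₂ := .mk' fun T hT h₁ h₃ P => by
    obtain ⟨N, hN⟩ := h₁ P
    obtain ⟨M, hM⟩ := h₃ P
    refine ⟨max N M, fun n hn => ?_⟩
    rw [exactAt_homTo_iff]
    have ex := (homologyHomTo V P n).map_distinguished_exact T hT
    exact ex.isZero_of_both_zeros
      (((exactAt_homTo_iff P n _).1 (hN n (lt_of_le_of_lt (le_max_left _ _) hn))).eq_of_src _ _)
      (((exactAt_homTo_iff P n _).1 (hM n (lt_of_le_of_lt (le_max_right _ _) hn))).eq_of_tgt _ _)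

/-- `K^{-,b}` is a triangulated subcategory of the homotopy category. -/
instance : (minusB V).IsTriangulated := by
  unfold minusB
  infer_instance

/-- The Verdier quotient `K^{-,b} / K^b`: the localization of `K^{-,b}` at the morphisms whose
mapping cone is in `K^b`. -/
abbrev Dst := (perf V).trW.Localization

end Triangulated

section Truncation

variable {V : Type u} [Category.{v} V] [Preadditive V] [HasZeroObject V]

/-- The brutal truncation `β_{≥ 0}(C)` (homological degrees): it keeps `C.X n` for `n ≤ 0`, and
its other terms are zero. -/
abbrev brutal (C : CochainComplex V ℤ) : CochainComplex V ℤ :=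
  C.stupidTrunc (ComplexShape.embeddingUpIntLE 0)

/-- The map of brutal truncations induced by a map of complexes. -/
abbrev brutalMap {C D : CochainComplex V ℤ} (f : C ⟶ D) : brutal C ⟶ brutal D :=
  HomologicalComplex.stupidTruncMap f (ComplexShape.embeddingUpIntLE 0)

lemma embedding_f_natAbs (n : ℤ) (hn : n ≤ 0) :
    (ComplexShape.embeddingUpIntLE 0).f n.natAbs = n := by
  change (0 : ℤ) - (n.natAbs : ℤ) = n
  omega

/-- In degrees `n ≤ 0`, the brutal truncation agrees with the complex. -/
def brutalXIso (C : CochainComplex V ℤ) (n : ℤ) (hn : n ≤ 0) : (brutal C).X n ≅ C.X n :=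
  C.stupidTruncXIso _ (embedding_f_natAbs n hn)

lemma isZero_brutal_X (C : CochainComplex V ℤ) (n : ℤ) (hn : 0 < n) : IsZero ((brutal C).X n) :=
  C.isZero_stupidTrunc_X _ _ ((ComplexShape.notMem_range_embeddingUpIntLE_iff 0 n).2 hn)

lemma brutal_d (C : CochainComplex V ℤ) (i j : ℤ) (hi : i ≤ 0) (hj : j ≤ 0) :
    (brutal C).d i j = (brutalXIso C i hi).hom ≫ C.d i j ≫ (brutalXIso C j hj).inv := by
  refine (HomologicalComplex.extend_d_eq _ _ (embedding_f_natAbs i hi)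
    (embedding_f_natAbs j hj)).trans ?_
  rw [HomologicalComplex.restriction_d_eq _ _ (embedding_f_natAbs i hi)
    (embedding_f_natAbs j hj)]
  have h (n : ℤ) (hn : n ≤ 0) : brutalXIso C n hn =
      (C.restriction (ComplexShape.embeddingUpIntLE 0)).extendXIso _ (embedding_f_natAbs n hn) ≪≫
        C.restrictionXIso _ (embedding_f_natAbs n hn) := rfl
  simp only [h, Iso.trans_hom, Iso.trans_inv, Category.assoc]
  exact (Category.assoc _ _ _).symm

lemma brutalMap_f {C D : CochainComplex V ℤ} (f : C ⟶ D) (n : ℤ) (hn : n ≤ 0) :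
    (brutalMap f).f n = (brutalXIso C n hn).hom ≫ f.f n ≫ (brutalXIso D n hn).inv := by
  rw [← Category.assoc, Iso.eq_comp_inv]
  exact HomologicalComplex.stupidTruncMap_stupidTruncXIso_hom f _ _

lemma exactAt_homTo_brutal {C : CochainComplex V ℤ} (P : V) (n : ℤ) (hn : n < 0)
    (h : (homTo P C).ExactAt n) : (homTo P (brutal C)).ExactAt n := by
  rw [HomologicalComplex.exactAt_iff' _ (n - 1) n (n + 1) (by simp) (by simp)] at h ⊢
  let F := preadditiveCoyoneda.obj (Opposite.op P)
  refine ShortComplex.exact_of_iso (ShortComplex.isoMk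
    (F.mapIso (brutalXIso C (n - 1) (by omega)).symm)
    (F.mapIso (brutalXIso C n (by omega)).symm)
    (F.mapIso (brutalXIso C (n + 1) (by omega)).symm) ?_ ?_) h
  · change F.map _ ≫ F.map _ = F.map _ ≫ F.map _
    rw [← F.map_comp, ← F.map_comp, brutal_d C (n - 1) n (by omega) (by omega)]
    simp
  · change F.map _ ≫ F.map _ = F.map _ ≫ F.map _
    rw [← F.map_comp, ← F.map_comp, brutal_d C n (n + 1) (by omega) (by omega)]
    simp

/-- The brutal truncation of a totally acyclic complex lies in `K^{-,b}`. -/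
lemma minusB_brutal (C : CochainComplex V ℤ) (hC : IsTotallyAcyclic C) :
    minusB V ((HomotopyCategory.quotient V (ComplexShape.up ℤ)).obj (brutal C)) := by
  refine ⟨ObjectProperty.le_isoClosure _ _ ⟨0, fun n hn => isZero_brutal_X C n hn⟩,
    fun P => ⟨0, fun n hn => ?_⟩⟩
  rcases lt_trichotomy n 0 with h | h | h
  · exact exactAt_homTo_brutal P n h (hC.1 P n)
  · simp [h] at hn
  · exact ShortComplex.exact_of_isZero_X₂ _ (Functor.map_isZero
      (preadditiveCoyoneda.obj (Opposite.op P)) (isZero_brutal_X C n h))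

/-- If `f` and `g` are homotopic, the difference of their brutal truncations factors, up to
homotopy, through a complex concentrated in degree `0`. -/
lemma brutalMap_homotopy {C D : CochainComplex V ℤ} {f g : C ⟶ D} (h : Homotopy f g) :
    ∃ (p : brutal C ⟶ (HomologicalComplex.single V (ComplexShape.up ℤ) 0).obj (C.X 1))
      (q : (HomologicalComplex.single V (ComplexShape.up ℤ) 0).obj (C.X 1) ⟶ brutal D),
      Nonempty (Homotopy (brutalMap f) (brutalMap g + p ≫ q)) := by
  classical
  refine ⟨HomologicalComplex.mkHomToSingle ((brutalXIso C 0 le_rfl).hom ≫ C.d 0 1) ?_,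
    HomologicalComplex.mkHomFromSingle (h.hom 1 0 ≫ (brutalXIso D 0 le_rfl).inv) ?_, ⟨?_⟩⟩
  · intro i hi
    obtain rfl : i = -1 := by have : i + 1 = 0 := hi; omega
    rw [brutal_d C (-1) 0 (by omega) le_rfl]
    simp
  · intro k hk
    obtain rfl : k = 1 := by have : 0 + 1 = k := hk; omega
    exact (isZero_brutal_X D 1 one_pos).eq_of_tgt _ _
  · refine
      { hom := fun i j => if hi : i ≤ 0 then if hj : j ≤ 0 then
          (brutalXIso C i hi).hom ≫ h.hom i j ≫ (brutalXIso D j hj).inv else 0 else 0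
        zero := fun i j hij => ?_
        comm := fun n => ?_ }
    · split_ifs
      · rw [h.zero i j hij]; simp
      · rfl
      · rfl
    · rcases lt_trichotomy n 0 with hn | rfl | hn
      · have e := h.comm n
        rw [dNext_eq _ (show (ComplexShape.up ℤ).Rel n (n + 1) from rfl),
          prevD_eq _ (show (ComplexShape.up ℤ).Rel (n - 1) n by simp)] at e ⊢
        rw [dif_pos (show n + 1 ≤ 0 by omega), dif_pos hn.le, dif_pos hn.le,
          dif_pos (show n - 1 ≤ 0 by omega), brutal_d C n (n + 1) hn.le (by omega),
          brutal_d D (n - 1) n (by omega) hn.le, HomologicalComplex.add_f_apply,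
          HomologicalComplex.comp_f, brutalMap_f f n hn.le, brutalMap_f g n hn.le, e,
          (HomologicalComplex.isZero_single_obj_X (ComplexShape.up ℤ) 0 (C.X 1) n
            (by omega)).eq_of_tgt (HomologicalComplex.Hom.f _ n) 0]
        simp
      · have e := h.comm 0
        rw [dNext_eq _ (show (ComplexShape.up ℤ).Rel 0 1 from rfl),
          prevD_eq _ (show (ComplexShape.up ℤ).Rel (-1) 0 by simp)] at e ⊢
        rw [dif_neg (show ¬ ((1 : ℤ) ≤ 0) by omega), dif_pos le_rfl,
          dif_pos (show (-1 : ℤ) ≤ 0 by omega),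
          brutal_d D (-1) 0 (by omega) le_rfl, HomologicalComplex.add_f_apply,
          HomologicalComplex.comp_f, brutalMap_f f 0 le_rfl, brutalMap_f g 0 le_rfl, e,
          HomologicalComplex.mkHomToSingle_f, HomologicalComplex.mkHomFromSingle_f]
        simp
        abel
      · exact (isZero_brutal_X D n hn).eq_of_tgt _ _

/-- A complex concentrated in degree `0` is an object of `K^{-,b}`. -/
lemma minusB_single (X : V) : minusB V ((HomotopyCategory.quotient V (ComplexShape.up ℤ)).obj
    ((HomologicalComplex.single V (ComplexShape.up ℤ) 0).obj X)) := by
  refine ⟨ObjectProperty.le_isoClosure _ _ ⟨0, fun n hn =>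
    HomologicalComplex.isZero_single_obj_X (ComplexShape.up ℤ) 0 X n (by omega)⟩,
    fun P => ⟨0, fun n hn => ShortComplex.exact_of_isZero_X₂ _ (Functor.map_isZero
      (preadditiveCoyoneda.obj (Opposite.op P))
      (HomologicalComplex.isZero_single_obj_X (ComplexShape.up ℤ) 0 X n (by
        rintro rfl; simp at hn)))⟩⟩

/-- The brutal truncation of an object of the category of totally acyclic complexes. -/
abbrev brutalObj (T : Ktac V) : KMinusB V :=
  ⟨(HomotopyCategory.quotient V (ComplexShape.up ℤ)).obj (brutal T.obj.as),
    minusB_brutal _ T.property⟩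

/-- The morphism of `K^{-,b}` given by the brutal truncation of a map of complexes. -/
abbrev brutalHom {T T' : Ktac V} (f : T.obj.as ⟶ T'.obj.as) : brutalObj T ⟶ brutalObj T' :=
  ObjectProperty.homMk ((HomotopyCategory.quotient V (ComplexShape.up ℤ)).map (brutalMap f))

lemma brutalHom_id (T : Ktac V) : brutalHom (T := T) (T' := T) (𝟙 _) = 𝟙 (brutalObj T) := by
  ext
  exact (congrArg (HomotopyCategory.quotient V (ComplexShape.up ℤ)).map
    (HomologicalComplex.stupidTruncMap_id _ _)).trans (CategoryTheory.Functor.map_id _ _)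

lemma brutalHom_comp {T₁ T₂ T₃ : Ktac V} (f : T₁.obj.as ⟶ T₂.obj.as)
    (g : T₂.obj.as ⟶ T₃.obj.as) :
    brutalHom (T := T₁) (T' := T₃) (f ≫ g) = brutalHom f ≫ brutalHom g := by
  ext
  exact (congrArg (HomotopyCategory.quotient V (ComplexShape.up ℤ)).map
    (HomologicalComplex.stupidTruncMap_comp _ _ _)).trans (Functor.map_comp _ _ _)

variable [HasBinaryBiproducts V]

/-- Two parallel maps of `K^{-,b}` whose difference factors through an object of `K^b` become
equal in the Verdier quotient. -/
lemma Q_map_eq {X Y Z : KMinusB V} (hZ : perf V Z) (a b : X ⟶ Y) (p : X ⟶ Z) (q : Z ⟶ Y)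
    (h : a = b + p ≫ q) : (perf V).trW.Q.map a = (perf V).trW.Q.map b := by
  obtain ⟨W, s, t, hT⟩ := Pretriangulated.distinguished_cocone_triangle q
  rw [MorphismProperty.map_eq_iff_postcomp _ (perf V).trW]
  refine ⟨W, s, ObjectProperty.trW.mk' _ hT hZ, ?_⟩
  have hqs : q ≫ s = 0 := Pretriangulated.comp_distTriang_mor_zero₁₂ _ hT
  rw [h, Preadditive.add_comp, Category.assoc, hqs, comp_zero, add_zero]

/-- In the Verdier quotient, the brutal truncation of a map only depends on its homotopy class. -/
lemma Q_map_brutalHom_eq {T T' : Ktac V} {f g : T.obj.as ⟶ T'.obj.as} (h : Homotopy f g) :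
    (perf V).trW.Q.map (brutalHom f) = (perf V).trW.Q.map (brutalHom g) := by
  obtain ⟨p, q, ⟨H⟩⟩ := brutalMap_homotopy h
  let Z : KMinusB V := ⟨_, minusB_single (T.obj.as.X 1)⟩
  refine Q_map_eq (Z := Z) (ObjectProperty.le_isoClosure _ _ ⟨0, fun n hn =>
    HomologicalComplex.isZero_single_obj_X (ComplexShape.up ℤ) 0 _ n (by
        rintro rfl; simp at hn)⟩) _ _
    (ObjectProperty.homMk ((HomotopyCategory.quotient V (ComplexShape.up ℤ)).map p))
    (ObjectProperty.homMk ((HomotopyCategory.quotient V (ComplexShape.up ℤ)).map q)) ?_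
  ext
  exact (HomotopyCategory.eq_of_homotopy _ _ H).trans (by
    rw [Functor.map_add, Functor.map_comp]; rfl)

variable (V) in
/-- The functor `β : K_tac ⥤ K^{-,b} / K^b` induced by brutal truncation at degree zero: on
morphisms it is the class of the brutal truncation of any representative chain map. -/
def beta : Ktac V ⥤ Dst V where
  obj T := (perf V).trW.Q.obj (brutalObj T)
  map f := (perf V).trW.Q.map (brutalHom (Quot.out f.hom))
  map_id T := (Q_map_brutalHom_eq (g := 𝟙 _) (HomotopyCategory.homotopyOfEq _ _
      (HomotopyCategory.quotient_map_out _))).trans <| by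
    rw [brutalHom_id]
    exact CategoryTheory.Functor.map_id _ _
  map_comp f g := (Q_map_brutalHom_eq (g := Quot.out f.hom ≫ Quot.out g.hom)
      (HomotopyCategory.homotopyOfEq _ _ ((HomotopyCategory.quotient_map_out _).trans
        (HomotopyCategory.quotient_map_out_comp_out f.hom g.hom).symm))).trans <| by
    rw [brutalHom_comp]
    exact Functor.map_comp _ _ _

end Truncation

section Rings

variable (A : Type u) [Ring A]

/-- Finitely generated projective left `A`-modules. -/
def isFGProjective : ObjectProperty (ModuleCat.{u} A) :=
  fun M => Module.Finite A M ∧ Module.Projective A M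

/-- The category `proj A` of finitely generated projective left `A`-modules. -/
abbrev Proj := (isFGProjective A).FullSubcategory

instance : (isFGProjective A).IsClosedUnderIsomorphisms where
  of_iso e h :=
    have := h.1
    have := h.2
    ⟨Module.Finite.equiv e.toLinearEquiv, Module.Projective.of_equiv e.toLinearEquiv⟩

instance : (isFGProjective A).ContainsZero where
  exists_zero := ⟨ModuleCat.of A PUnit, ModuleCat.isZero_of_subsingleton _,
    inferInstance, inferInstance⟩

instance : (isFGProjective A).IsClosedUnderBinaryProducts where
  limitsOfShape_le := by
    rintro X ⟨p⟩
    have h₁ := p.prop_diag_obj (.mk .left)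
    have h₂ := p.prop_diag_obj (.mk .right)
    have : Module.Finite A (p.diag.obj (.mk .left)) := h₁.1
    have : Module.Finite A (p.diag.obj (.mk .right)) := h₂.1
    have : Module.Projective A (p.diag.obj (.mk .left)) := h₁.2
    have : Module.Projective A (p.diag.obj (.mk .right)) := h₂.2
    refine (isFGProjective A).prop_of_iso (X := ModuleCat.of A
      (p.diag.obj (.mk .left) × p.diag.obj (.mk .right))) ?_ ⟨?_, ?_⟩
    · exact IsLimit.conePointUniqueUpToIso (ModuleCat.binaryProductLimitCone _ _).isLimit
        ((IsLimit.postcomposeHomEquiv (diagramIsoPair p.diag) _).2 p.isLimit)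
    · exact inferInstanceAs (Module.Finite A
        (p.diag.obj (.mk .left) × p.diag.obj (.mk .right)))
    · exact inferInstanceAs (Module.Projective A
        (p.diag.obj (.mk .left) × p.diag.obj (.mk .right)))

/-- The category `proj A` is additive. -/
instance : HasBinaryBiproducts (Proj A) :=
  HasBinaryBiproducts.of_hasBinaryProducts

end Rings

end

end StableDerived

/-! Fix a finitely generated projective `X`, placed in degree `0`, and consider the complexes `Z` in
`K^{-,b}` with `Hom(Z, X⟦n⟧) = 0` for `n ≫ 0`. Bounded complexes have this property for degree
reasons. So do brutal truncations of totally acyclic complexes, because `Hom(C, X)` is acyclic. The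
property survives isomorphism in the Verdier quotient
(`IsEventuallyOrthogonal.of_localization_iso`), so density of `β` gives it to every object of
`K^{-,b}` (`exists_cocycle_factors_of_essSurj`).

For a resolution of a finitely generated module `M` by finitely generated projectives, these Hom
groups are `Extⁿ(M, X)`. Hence some positive Ext group of `M` into `X` vanishes
(`exists_subsingleton_ext_of_essSurj`). The degree may depend on `M`, so a uniform bound requires a
single test module. Over an Artinian ring `A ⧸ J`, with `J` the Jacobson radical, is one: every
simple module is a summand of it and every cyclic module has finite length. By Baer's criterion and
dimension shifting, vanishing of `Extⁿ⁺¹(A ⧸ J, A)` alone bounds the injective dimension of `A` by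
`n` (`hasInjectiveDimensionLE_of_jacobson_quotient`). -/

namespace StableDerived

open CategoryTheory CategoryTheory.Limits ZeroObject Abelian

/-! ### Eventual orthogonality in a triangulated category and its Verdier quotients. -/

section Orthogonality

variable {C : Type u} [Category.{v} C] [Preadditive C] [HasShift C ℤ]

/-- `X` has no nonzero maps to `T⟦n⟧` for `n ≫ 0`. -/
def IsEventuallyOrthogonal (T X : C) : Prop :=
  ∃ N : ℤ, ∀ n : ℤ, N < n → ∀ f : X ⟶ T⟦n⟧, f = 0

lemma IsEventuallyOrthogonal.of_iso {T X Y : C} (e : X ≅ Y) (hX : IsEventuallyOrthogonal T X) :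
    IsEventuallyOrthogonal T Y := by
  obtain ⟨N, hN⟩ := hX
  refine ⟨N, fun n hn f => ?_⟩
  rw [← cancel_epi e.hom, hN n hn (e.hom ≫ f), comp_zero]

variable [HasZeroObject C] [∀ n : ℤ, (shiftFunctor C n).Additive] [Pretriangulated C]

variable {T : C} {P : ObjectProperty C} (hP : ∀ Z, P Z → IsEventuallyOrthogonal T Z)
include hP

/-- In the triangle on `s`, a map `Y ⟶ T⟦n⟧` that vanishes on `X` factors through the cone, which
lies in `P`. -/
lemma IsEventuallyOrthogonal.of_trW {X Y : C} {s : X ⟶ Y} (hs : P.trW s)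
    (hX : IsEventuallyOrthogonal T X) : IsEventuallyOrthogonal T Y := by
  rw [ObjectProperty.trW_iff] at hs
  obtain ⟨Z, g, h, hT, hZ⟩ := hs
  obtain ⟨N, hN⟩ := hX
  obtain ⟨M, hM⟩ := hP Z hZ
  refine ⟨max N M, fun n hn f => ?_⟩
  obtain ⟨k, rfl⟩ := Pretriangulated.Triangle.yoneda_exact₂ _ hT f
    (hN n (lt_of_le_of_lt (le_max_left _ _) hn) _)
  rw [hM n (lt_of_le_of_lt (le_max_right _ _) hn) k]
  exact comp_zero

/-- Modulo `P`, the object `X` is a retract of `Y`. A map `X ⟶ T⟦n⟧` dies on the fibre of `a ≫ b`,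
hence extends along `a ≫ b` and so factors through `Y`. -/
lemma IsEventuallyOrthogonal.of_trW_comp [P.IsStableUnderShift ℤ] {X Y Z : C} (a : X ⟶ Y) (b : Y ⟶ Z) (h : P.trW (a ≫ b))
    (hY : IsEventuallyOrthogonal T Y) : IsEventuallyOrthogonal T X := by
  rw [ObjectProperty.trW_iff'] at h
  obtain ⟨W, g, h, hT, hW⟩ := h
  obtain ⟨N, hN⟩ := hY
  obtain ⟨M, hM⟩ := hP W hW
  refine ⟨max N M, fun n hn f => ?_⟩
  obtain ⟨k : Z ⟶ T⟦n⟧, hk : f = (a ≫ b) ≫ k⟩ := Pretriangulated.Triangle.yoneda_exact₂ _ hT f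
    (hM n (lt_of_le_of_lt (le_max_right _ _) hn) _)
  rw [hk, Category.assoc, hN n (lt_of_le_of_lt (le_max_left _ _) hn) (b ≫ k), comp_zero]

/-- Eventual orthogonality to `T` is invariant under isomorphisms in the Verdier quotient by a
triangulated subcategory whose objects are eventually orthogonal to `T`. -/
lemma IsEventuallyOrthogonal.of_localization_iso [IsTriangulated C] [P.IsTriangulated] {X Y : C}
    (e : P.trW.Q.obj X ≅ P.trW.Q.obj Y) (hY : IsEventuallyOrthogonal T Y) :
    IsEventuallyOrthogonal T X := by
  obtain ⟨φ, hφ⟩ := Localization.exists_leftFraction P.trW.Q P.trW e.hom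
  have hs := Localization.inverts P.trW.Q P.trW φ.s φ.hs
  have hf : P.trW.Q.map φ.f = e.hom ≫ P.trW.Q.map φ.s := by
    rw [hφ, MorphismProperty.LeftFraction.map_comp_map_s]
  -- That `φ.f` becomes invertible does not put it in `trW`, since `P` is not assumed closed under
  -- direct summands. A fraction `ψ` for the inverse is used instead: a composite starting with
  -- `φ.f` then lies in `trW`, which suffices for `of_trW_comp`.
  obtain ⟨ψ, hψ⟩ := Localization.exists_leftFraction P.trW.Q P.trW
    (inv (P.trW.Q.map φ.s) ≫ e.inv)
  have hg : P.trW.Q.map ψ.f = (inv (P.trW.Q.map φ.s) ≫ e.inv) ≫ P.trW.Q.map ψ.s := by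
    rw [hψ, MorphismProperty.LeftFraction.map_comp_map_s]
  have key : P.trW.Q.map (φ.f ≫ ψ.f) = P.trW.Q.map ψ.s := by
    rw [Functor.map_comp, hf, hg]
    simp
  rw [MorphismProperty.map_eq_iff_postcomp P.trW.Q P.trW] at key
  obtain ⟨V, t, ht, h⟩ := key
  refine IsEventuallyOrthogonal.of_trW_comp hP φ.f (ψ.f ≫ t) ?_ (.of_trW hP φ.hs hY)
  rw [← Category.assoc, h]
  exact P.trW.comp_mem _ _ ψ.hs ht

end Orthogonality

/-! ### Maps from a complex to a shifted object concentrated in one degree. -/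

section HomotopyCategory

variable {V : Type u} [Category.{v} V] [Preadditive V]

lemma homTo_exactAt_iff (P : V) (C : CochainComplex V ℤ) (n : ℤ) :
    (homTo P C).ExactAt n ↔ ∀ x : P ⟶ C.X n, x ≫ C.d n (n + 1) = 0 →
      ∃ y : P ⟶ C.X (n - 1), y ≫ C.d (n - 1) n = x := by
  rw [HomologicalComplex.exactAt_iff' _ (n - 1) n (n + 1) (by simp) (by simp),
    ShortComplex.ab_exact_iff]
  exact Iff.rfl

lemma homFrom_exactAt_iff (C : CochainComplex V ℤ) (P : V) (n : ℤ) :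
    (homFrom C P).ExactAt n ↔ ∀ x : C.X n ⟶ P, C.d (n - 1) n ≫ x = 0 →
      ∃ y : C.X (n + 1) ⟶ P, C.d n (n + 1) ≫ y = x := by
  rw [HomologicalComplex.exactAt_iff' _ (n + 1) n (n - 1)
      (ComplexShape.prev_eq' _ (show n + 1 = n + 1 from rfl))
      (ComplexShape.next_eq' _ (show n - 1 + 1 = n by omega)),
    ShortComplex.ab_exact_iff]
  exact Iff.rfl

variable [HasZeroObject V]

/-- The complex `X⟦n⟧` sits in degree `-n`, so a chain map into it is a cocycle of `Hom(K, X)`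
there, and it is null-homotopic exactly when that cocycle is a coboundary. -/
lemma quotient_hom_single_shift_eq_zero_iff (K : CochainComplex V ℤ) (X : V) (n : ℤ) :
    (∀ f : (HomotopyCategory.quotient V (ComplexShape.up ℤ)).obj K ⟶
      (HomotopyCategory.quotient V (ComplexShape.up ℤ)).obj
        (((HomologicalComplex.single V (ComplexShape.up ℤ) 0).obj X)⟦n⟧), f = 0) ↔
    ∀ x : K.X (-n) ⟶ X, K.d (-n - 1) (-n) ≫ x = 0 →
      ∃ y : K.X (-n + 1) ⟶ X, K.d (-n) (-n + 1) ≫ y = x := by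
  open CochainComplex.HomComplex in
  constructor
  · intro h x hx
    rw [← Cocycle.toSingleMk_mem_coboundaries_iff (n := n) (q := 0) x (by omega)
      (-n - 1) (by omega) hx (-n + 1) rfl, ← CohomologyClass.toHom_mk_eq_zero_iff]
    exact h _
  · intro h f
    obtain ⟨c, rfl⟩ := (CohomologyClass.toHom_bijective K
      ((CochainComplex.singleFunctor V 0).obj X) n).2 f
    obtain ⟨z, rfl⟩ := c.mk_surjective
    obtain ⟨x, hx, rfl⟩ := Cocycle.toSingleMk_surjective z (-n) (by omega) (-n - 1) (by omega)
    refine (CohomologyClass.toHom_mk_eq_zero_iff _).2 ?_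
    rw [Cocycle.toSingleMk_mem_coboundaries_iff x (by omega) (-n - 1) (by omega) hx (-n + 1) rfl]
    exact h x hx

variable [HasBinaryBiproducts V]

/-- A complex concentrated in degree `0`, as an object of `K^{-,b}`. -/
noncomputable abbrev singleObj (X : V) : KMinusB V := ⟨_, minusB_single X⟩

lemma hom_singleObj_shift_eq_zero_iff (K : CochainComplex V ℤ)
    (hK : minusB V ((HomotopyCategory.quotient V (ComplexShape.up ℤ)).obj K)) (X : V) (n : ℤ) :
    (∀ f : (⟨_, hK⟩ : KMinusB V) ⟶ (singleObj X)⟦n⟧, f = 0) ↔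
    ∀ x : K.X (-n) ⟶ X, K.d (-n - 1) (-n) ≫ x = 0 →
      ∃ y : K.X (-n + 1) ⟶ X, K.d (-n) (-n + 1) ≫ y = x := by
  rw [← quotient_hom_single_shift_eq_zero_iff]
  -- The shift of the full subcategory is compared with that of complexes through two canonical
  -- isomorphisms.
  let e : ((singleObj X)⟦n⟧ : KMinusB V).obj ≅
      (HomotopyCategory.quotient V (ComplexShape.up ℤ)).obj
        (((HomologicalComplex.single V (ComplexShape.up ℤ) 0).obj X)⟦n⟧) :=
    ((minusB V).ι.commShiftIso n).app (singleObj X) ≪≫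
      (((HomotopyCategory.quotient V (ComplexShape.up ℤ)).commShiftIso n).app _).symm
  constructor
  · intro h f
    have h1 := h (ObjectProperty.homMk (f ≫ e.inv))
    have h2 : f ≫ e.inv = 0 := congrArg (fun g => (minusB V).ι.map g) h1
    rw [← cancel_mono e.inv, h2, zero_comp]
  · intro h f
    ext
    have h1 := h (f.hom ≫ e.hom)
    rw [← cancel_mono e.hom]
    exact h1.trans zero_comp.symm

instance : (minusB V).IsClosedUnderIsomorphisms := by
  unfold minusB
  infer_instance

lemma isEventuallyOrthogonal_of_perf (X : V) (Z : KMinusB V) (hZ : perf V Z) :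
    IsEventuallyOrthogonal (singleObj X) Z := by
  obtain ⟨Y, ⟨N, hN⟩, ⟨e⟩⟩ := hZ
  have hY : minusB V Y := (minusB V).prop_of_iso e Z.property
  refine IsEventuallyOrthogonal.of_iso (X := ⟨Y, hY⟩) ((minusB V).isoMk e.symm)
    ⟨max N 0, fun n hn => ?_⟩
  obtain ⟨K, rfl⟩ := Y.quotient_obj_surjective
  rw [hom_singleObj_shift_eq_zero_iff]
  refine fun x _ => ⟨0, (hN (-n) ?_).eq_of_src _ _⟩
  rw [abs_neg]
  exact lt_of_lt_of_le (lt_of_le_of_lt (le_max_left _ _) hn) (le_abs_self n)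

/-- For `n > 0` the degrees `-n - 1`, `-n`, `-n + 1` are all at most `0`, so truncation does not
affect them and acyclicity of `Hom(C, X)` applies. -/
lemma isEventuallyOrthogonal_brutalObj (X : V) (T : Ktac V) :
    IsEventuallyOrthogonal (singleObj X) (brutalObj T) := by
  refine ⟨0, fun n hn => ?_⟩
  rw [hom_singleObj_shift_eq_zero_iff]
  intro x hx
  rw [brutal_d _ _ _ (by omega) (by omega)] at hx
  obtain ⟨y, hy⟩ := (homFrom_exactAt_iff _ X (-n)).1 (T.property.2 X (-n))
    ((brutalXIso _ (-n) (by omega)).inv ≫ x) (by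
      rw [← cancel_epi (brutalXIso _ (-n - 1) (by omega)).hom, comp_zero]
      simpa using hx)
  refine ⟨(brutalXIso _ (-n + 1) (by omega)).hom ≫ y, ?_⟩
  rw [brutal_d _ _ _ (by omega) (by omega)]
  simp [hy]

/-- If the functor `β` is dense, then for every complex `K` in `K^{-,b}` and every object `X`, the
cohomology of `Hom(K, X)` vanishes in all large degrees. -/
lemma exists_cocycle_factors_of_essSurj [(beta V).EssSurj] (K : CochainComplex V ℤ)
    (hK : minusB V ((HomotopyCategory.quotient V (ComplexShape.up ℤ)).obj K)) (X : V) :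
    ∃ N : ℤ, ∀ n, N < n → ∀ x : K.X (-n) ⟶ X, K.d (-n - 1) (-n) ≫ x = 0 →
      ∃ y : K.X (-n + 1) ⟶ X, K.d (-n) (-n + 1) ≫ y = x := by
  let Z : KMinusB V := ⟨_, hK⟩
  obtain ⟨N, hN⟩ := IsEventuallyOrthogonal.of_localization_iso
    (isEventuallyOrthogonal_of_perf X)
    ((beta V).objObjPreimageIso ((perf V).trW.Q.obj Z)).symm
    (isEventuallyOrthogonal_brutalObj X _)
  exact ⟨N, fun n hn => (hom_singleObj_shift_eq_zero_iff K hK X n).1 (hN n hn)⟩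

end HomotopyCategory

/-! ### Testing injective dimension with Ext groups. -/

section Ext

variable {A : Type u} [Ring A]

/-- The obstruction to extending `I → X` to `A` is its connecting class in `Ext¹(A ⧸ I, X)`. -/
lemma baer_of_subsingleton_ext_one (X : ModuleCat.{u} A)
    (h : ∀ I : Ideal A, Subsingleton (Ext (ModuleCat.of A (A ⧸ I)) X 1)) :
    Module.Baer A X := by
  intro I g
  have hS := LinearMap.shortExact_shortComplexKer (Submodule.mkQ_surjective I)
  have := h I
  obtain ⟨x, hx⟩ := Ext.contravariant_sequence_exact₁ hS X
    (Ext.mk₀ (ModuleCat.ofHom (g ∘ₗ Submodule.inclusion (Submodule.ker_mkQ I).le))) (add_zero 1)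
    (Subsingleton.elim _ _)
  obtain ⟨f, rfl⟩ := Ext.mk₀_bijective _ _ |>.2 x
  rw [Ext.mk₀_comp_mk₀] at hx
  have hf := Ext.mk₀_bijective _ _ |>.1 hx
  refine ⟨f.hom, fun a ha => ?_⟩
  exact congr($(hf).hom ⟨a, (Submodule.ker_mkQ I).ge ha⟩)

/-- A bound on injective dimension can be tested on cyclic modules. -/
lemma hasInjectiveDimensionLE_of_cyclic (n : ℕ) (X : ModuleCat.{u} A)
    (h : ∀ I : Ideal A, Subsingleton (Ext (ModuleCat.of A (A ⧸ I)) X (n + 1))) :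
    HasInjectiveDimensionLE X n := by
  induction n generalizing X with
  | zero =>
    have : Module.Injective A X := (baer_of_subsingleton_ext_one X h).injective
    have : Injective X := (Module.injective_iff_injective_object A X).1 this
    exact inferInstanceAs (HasInjectiveDimensionLT X 1)
  | succ n ih =>
    -- Dimension shifting: embed `X` in an injective `J`. The cokernel has injective dimension one
    -- lower, and its Ext groups against `A ⧸ I` inject into those of `X` one degree up.
    obtain ⟨J, _, f, _⟩ := EnoughInjectives.presentation X
    have hS : (ShortComplex.mk f _ (cokernel.condition f)).ShortExact :=
      { exact := ShortComplex.exact_cokernel f }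
    refine (hS.hasInjectiveDimensionLT_X₃_iff n inferInstance).1 (ih _ fun I => ?_)
    have := h I
    refine subsingleton_of_forall_eq 0 fun x => ?_
    obtain ⟨y, rfl⟩ := Ext.covariant_sequence_exact₃ _ hS x rfl (Subsingleton.elim _ _)
    rw [Ext.eq_zero_of_injective y, Ext.zero_comp]

lemma subsingleton_ext_of_shortExact {S : ShortComplex (ModuleCat.{u} A)} (hS : S.ShortExact)
    (X : ModuleCat.{u} A) (n : ℕ) (h₁ : Subsingleton (Ext S.X₁ X n))
    (h₃ : Subsingleton (Ext S.X₃ X n)) : Subsingleton (Ext S.X₂ X n) := by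
  refine subsingleton_of_forall_eq 0 fun x => ?_
  obtain ⟨y, rfl⟩ := Ext.contravariant_sequence_exact₂ hS X x (Subsingleton.elim _ _)
  rw [Subsingleton.elim y 0, Ext.comp_zero]

lemma subsingleton_ext_of_retract {X Y : ModuleCat.{u} A} (r : Retract X Y)
    (Z : ModuleCat.{u} A) (n : ℕ) (h : Subsingleton (Ext Y Z n)) : Subsingleton (Ext X Z n) := by
  refine subsingleton_of_forall_eq 0 fun x => ?_
  have : (Ext.mk₀ r.i).comp ((Ext.mk₀ r.r).comp x (zero_add n)) (zero_add n) = x := by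
    rw [Ext.mk₀_comp_mk₀_assoc, r.retract, Ext.mk₀_id_comp]
  rw [← this, Subsingleton.elim ((Ext.mk₀ r.r).comp x (zero_add n)) 0, Ext.comp_zero]

end Ext

/-! ### Reduction to the ring modulo its Jacobson radical. -/

section Artinian

variable {A : Type u} [Ring A] [IsArtinianRing A]

/-- The quotient ring is semisimple over itself. The identity, semilinear along the surjection from
`A`, transfers this to the `A`-module structure. -/
lemma isSemisimpleModule_quotient_jacobson :
    IsSemisimpleModule A (A ⧸ Ring.jacobson A) := by
  let l : (A ⧸ Ring.jacobson A) →ₛₗ[Ideal.Quotient.mk (Ring.jacobson A)] (A ⧸ Ring.jacobson A) :=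
    { AddMonoidHom.id _ with
      map_smul' := fun a x => by
        obtain ⟨x, rfl⟩ := Ideal.Quotient.mk_surjective x
        rfl }
  exact (l.isSemisimpleModule_iff_of_bijective Function.bijective_id).2 inferInstance

/-- Over an Artinian ring, every simple module is a direct summand of the ring modulo its
Jacobson radical. -/
lemma nonempty_retract_of_isSimpleModule (S : Type u) [AddCommGroup S] [Module A S]
    [IsSimpleModule A S] :
    Nonempty (Retract (ModuleCat.of A S) (ModuleCat.of A (A ⧸ Ring.jacobson A))) := by
  have := IsSimpleModule.nontrivial A S
  have := isSemisimpleModule_quotient_jacobson (A := A)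
  obtain ⟨s, hs⟩ := exists_ne (0 : S)
  let f : (A ⧸ Ring.jacobson A) →ₗ[A] S := Submodule.liftQ (Ring.jacobson A)
    (LinearMap.toSpanSingleton A S s) fun a ha =>
      Module.mem_annihilator.1 (IsSemisimpleModule.jacobson_le_annihilator A S ha) s
  have hf : Function.Surjective f := by
    refine LinearMap.surjective_of_ne_zero fun h => hs ?_
    have h1 : LinearMap.toSpanSingleton A S s 1 = 0 := congr($h (Submodule.Quotient.mk 1))
    rwa [LinearMap.toSpanSingleton_apply, one_smul] at h1
  -- The surjection `f` splits because its source is semisimple.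
  obtain ⟨g, hg⟩ := IsSemisimpleModule.lifting_property f hf LinearMap.id
  exact ⟨⟨ModuleCat.ofHom g, ModuleCat.ofHom f, by rw [← ModuleCat.ofHom_comp, hg]; rfl⟩⟩

/-- Induction along a composition series: each simple factor is a retract of `A ⧸ J`, and vanishing
of Ext passes to extensions. The zero module is a retract as well, through zero maps. -/
lemma subsingleton_ext_of_jacobson_quotient (X : ModuleCat.{u} A) (n : ℕ)
    (h : Subsingleton (Ext (ModuleCat.of A (A ⧸ Ring.jacobson A)) X n))
    (M : Type u) [AddCommGroup M] [Module A M] (hM : IsFiniteLength A M) :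
    Subsingleton (Ext (ModuleCat.of A M) X n) := by
  induction hM with
  | of_subsingleton =>
    exact subsingleton_ext_of_retract
      ⟨0, 0, (ModuleCat.isZero_of_subsingleton _).eq_of_src _ _⟩ X n h
  | @of_simple_quotient M _ _ N _ hN ih =>
    refine subsingleton_ext_of_shortExact
      (S := ModuleCat.shortComplexOfCompEqZero N.subtype N.mkQ (by ext; simp)) ?_ X n ih ?_
    · exact ModuleCat.shortComplex_shortExact _ (LinearMap.exact_subtype_mkQ N)
        N.injective_subtype N.mkQ_surjective
    · obtain ⟨r⟩ := nonempty_retract_of_isSimpleModule (A := A) (M ⧸ N)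
      exact subsingleton_ext_of_retract r X n h

/-- Over an Artinian ring, a bound on injective dimension can be tested on the ring modulo its
Jacobson radical. -/
lemma hasInjectiveDimensionLE_of_jacobson_quotient (X : ModuleCat.{u} A) (n : ℕ)
    (h : Subsingleton (Ext (ModuleCat.of A (A ⧸ Ring.jacobson A)) X (n + 1))) :
    HasInjectiveDimensionLE X n :=
  hasInjectiveDimensionLE_of_cyclic n X fun I =>
    subsingleton_ext_of_jacobson_quotient X (n + 1) h (A ⧸ I)
      (((IsArtinianRing.tfae A (A ⧸ I)).out 0 3).1
        (inferInstance : Module.Finite A (A ⧸ I)))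

end Artinian

/-! ### Nonnegative chain complexes as objects of `K^{-,b}`. -/

section Extension

variable {V : Type u} [Category.{v} V] [Preadditive V] [HasZeroObject V]

/-- A chain complex indexed by `ℕ`, viewed as a cochain complex in nonpositive degrees. -/
noncomputable abbrev toCochain (R : ChainComplex V ℕ) : CochainComplex V ℤ :=
  R.extend ComplexShape.embeddingDownNat

/-- The term of `toCochain R` in degree `-m`. -/
noncomputable def toCochainXIso (R : ChainComplex V ℕ) (m : ℕ) {n : ℤ} (h : -(m : ℤ) = n) :
    (toCochain R).X n ≅ R.X m :=
  R.extendXIso _ h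

lemma toCochain_d (R : ChainComplex V ℕ) {i j : ℕ} {i' j' : ℤ} (hi : -(i : ℤ) = i')
    (hj : -(j : ℤ) = j') :
    (toCochain R).d i' j' = (toCochainXIso R i hi).hom ≫ R.d i j ≫ (toCochainXIso R j hj).inv :=
  R.extend_d_eq _ hi hj

lemma isZero_toCochain_X (R : ChainComplex V ℕ) (n : ℤ) (hn : 0 < n) :
    IsZero ((toCochain R).X n) :=
  R.isZero_extend_X _ _ fun i hi => by
    have : -(i : ℤ) = n := hi
    omega

/-- The bound `0` in eventual acyclicity leaves degree `0` unconstrained, which is where a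
resolution has its homology. -/
lemma minusB_toCochain (R : ChainComplex V ℕ)
    (h : ∀ (P : V) (m : ℕ) (x : P ⟶ R.X (m + 1)), x ≫ R.d (m + 1) m = 0 →
      ∃ y : P ⟶ R.X (m + 2), y ≫ R.d (m + 2) (m + 1) = x) :
    minusB V ((HomotopyCategory.quotient V (ComplexShape.up ℤ)).obj (toCochain R)) := by
  refine ⟨ObjectProperty.le_isoClosure _ _ ⟨0, isZero_toCochain_X R⟩, fun P => ⟨0, fun n hn => ?_⟩⟩
  refine (homTo_exactAt_iff P (toCochain R) n).2 fun x hx => ?_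
  rcases lt_or_ge 0 n with h0 | h0
  · exact ⟨0, (isZero_toCochain_X R n h0).eq_of_tgt _ _⟩
  · obtain ⟨m, rfl⟩ : ∃ m : ℕ, n = -((m + 1 : ℕ) : ℤ) := by
      rw [abs_pos] at hn
      exact ⟨(-n - 1).toNat, by omega⟩
    rw [toCochain_d R (i := m + 1) (j := m) rfl (by omega)] at hx
    obtain ⟨y, hy⟩ := h P m (x ≫ (toCochainXIso R (m + 1) rfl).hom) (by
      rw [← cancel_mono (toCochainXIso R m (n := -((m + 1 : ℕ) : ℤ) + 1) (by omega)).inv]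
      simpa using hx)
    refine ⟨y ≫ (toCochainXIso R (m + 2) (by omega)).inv, ?_⟩
    rw [toCochain_d R (i := m + 2) (j := m + 1) (by omega) rfl]
    simp [reassoc_of% hy]

/-- If the functor `β` is dense, then for a chain complex `R` that is exact in positive degrees,
the cohomology of `Hom(R, X)` vanishes in all large degrees. -/
lemma exists_chain_cocycle_factors_of_essSurj [HasBinaryBiproducts V] [(beta V).EssSurj]
    (R : ChainComplex V ℕ)
    (h : ∀ (P : V) (m : ℕ) (x : P ⟶ R.X (m + 1)), x ≫ R.d (m + 1) m = 0 →
      ∃ y : P ⟶ R.X (m + 2), y ≫ R.d (m + 2) (m + 1) = x) (X : V) :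
    ∃ N : ℕ, ∀ n, N ≤ n → ∀ x : R.X (n + 1) ⟶ X, R.d (n + 2) (n + 1) ≫ x = 0 →
      ∃ y : R.X n ⟶ X, R.d (n + 1) n ≫ y = x := by
  obtain ⟨N, hN⟩ := exists_cocycle_factors_of_essSurj _ (minusB_toCochain R h) X
  refine ⟨N.toNat, fun n hn x hx => ?_⟩
  obtain ⟨y, hy⟩ := hN (n + 1 : ℕ) (by omega) ((toCochainXIso R (n + 1) rfl).hom ≫ x) (by
    rw [toCochain_d R (i := n + 2) (j := n + 1) (by omega) rfl]
    simp [hx])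
  refine ⟨(toCochainXIso R n (n := -((n + 1 : ℕ) : ℤ) + 1) (by omega)).inv ≫ y, ?_⟩
  rw [toCochain_d R (i := n + 1) (j := n) rfl (by omega)] at hy
  rw [← cancel_epi (toCochainXIso R (n + 1) rfl).hom]
  simpa using hy

end Extension

/-! ### Projective resolutions, syzygies and Ext. -/

section Resolution

variable (A : Type u) [Ring A]

/-- A projective resolution by finitely generated modules, cut into the short exact sequences
`0 ⟶ Ωₙ₊₁ ⟶ Fₙ ⟶ Ωₙ ⟶ 0`. -/
structure SyzygySequence where
  /-- The syzygies; the module being resolved is `syz 0`. -/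
  syz : ℕ → ModuleCat.{u} A
  /-- The terms of the resolution. -/
  term : ℕ → Proj A
  /-- The inclusion of a syzygy. -/
  ι (n : ℕ) : syz (n + 1) ⟶ (term n).obj
  /-- The projection onto a syzygy. -/
  π (n : ℕ) : (term n).obj ⟶ syz n
  zero (n : ℕ) : ι n ≫ π n = 0
  shortExact (n : ℕ) : (ShortComplex.mk (ι n) (π n) (zero n)).ShortExact

variable {A}

/-- Over a Noetherian ring, every finitely generated module has a resolution by finitely generated
projective modules. -/
lemma exists_syzygySequence [IsNoetherianRing A] (M : ModuleCat.{u} A) (hM : Module.Finite A M) :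
    ∃ R : SyzygySequence A, R.syz 0 = M := by
  choose k f hf using fun N : {M : ModuleCat.{u} A // Module.Finite A M} =>
    have := N.2
    Module.Finite.exists_fin' A N.1
  let Ω : ℕ → {M : ModuleCat.{u} A // Module.Finite A M} := fun n =>
    Nat.rec ⟨M, hM⟩ (fun _ N => ⟨ModuleCat.of A (LinearMap.ker (f N)),
      inferInstanceAs (Module.Finite A (LinearMap.ker (f N)))⟩) n
  exact ⟨{
    syz := fun n => (Ω n).1
    term := fun n => ⟨ModuleCat.of A (Fin (k (Ω n)) → A),
      inferInstanceAs (Module.Finite A (Fin (k (Ω n)) → A)),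
      inferInstanceAs (Module.Projective A (Fin (k (Ω n)) → A))⟩
    ι := fun n => (f (Ω n)).shortComplexKer.f
    π := fun n => (f (Ω n)).shortComplexKer.g
    zero := fun n => (f (Ω n)).shortComplexKer.zero
    shortExact := fun n => LinearMap.shortExact_shortComplexKer (hf (Ω n)) }, rfl⟩

namespace SyzygySequence

variable (R : SyzygySequence A)

instance (n : ℕ) : Mono (R.ι n) := (R.shortExact n).mono_f

instance (n : ℕ) : Epi (R.π n) := (R.shortExact n).epi_g

instance (n : ℕ) : Projective (R.term n).obj := by
  have := (R.term n).property.2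
  infer_instance

/-- The differential of the resolution. -/
abbrev δ (n : ℕ) : R.term (n + 1) ⟶ R.term n := ObjectProperty.homMk (R.π (n + 1) ≫ R.ι n)

/-- The resolution as a chain complex. -/
noncomputable def complex : ChainComplex (Proj A) ℕ :=
  ChainComplex.of R.term R.δ fun n => by
    ext : 1
    change (R.π (n + 2) ≫ R.ι (n + 1)) ≫ R.π (n + 1) ≫ R.ι n = 0
    rw [Category.assoc, reassoc_of% R.zero, zero_comp, comp_zero]

lemma complex_d (n : ℕ) : R.complex.d (n + 1) n = R.δ n :=
  ChainComplex.of_d R.term R.δ n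

/-- Since `R.ι m` is mono, a cycle is killed by `R.π (m + 1)` and so factors through the next
syzygy. Projectivity of `P` then lifts it to the term covering that syzygy. -/
lemma complex_exact (P : Proj A) (m : ℕ) (x : P ⟶ R.complex.X (m + 1))
    (hx : x ≫ R.complex.d (m + 1) m = 0) :
    ∃ y : P ⟶ R.complex.X (m + 2), y ≫ R.complex.d (m + 2) (m + 1) = x := by
  rw [complex_d] at hx
  have := P.property.2
  let x' : P.obj ⟶ (R.term (m + 1)).obj := x.hom
  have hx' : x' ≫ R.π (m + 1) ≫ R.ι m = 0 := congrArg (fun g => g.hom) hx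
  have hx'' : x' ≫ R.π (m + 1) = 0 := by
    rw [← cancel_mono (R.ι m), Category.assoc, hx', zero_comp]
  have := (R.shortExact (m + 1)).mono_f
  let z : P.obj ⟶ R.syz (m + 2) := (R.shortExact (m + 1)).exact.lift x' hx''
  have hz : z ≫ R.ι (m + 1) = x' := (R.shortExact (m + 1)).exact.lift_f x' hx''
  let w : P.obj ⟶ (R.term (m + 2)).obj := Projective.factorThru z (R.π (m + 2))
  refine ⟨ObjectProperty.homMk w, ?_⟩
  rw [complex_d]
  ext : 1
  change w ≫ R.π (m + 2) ≫ R.ι (m + 1) = x'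
  rw [Projective.factorThru_comp_assoc, hz]

/-- Every class in `Ext¹` of the syzygy comes from some `φ : R.syz (n + 1) ⟶ X.obj`, as the middle
term is projective. Composing `φ` with `R.π (n + 1)` gives a cocycle; writing it as a coboundary and
cancelling the epi extends `φ` along `R.ι n`, so the class vanishes. -/
lemma subsingleton_ext_one_syz (X : Proj A) (n : ℕ)
    (h : ∀ x : R.complex.X (n + 1) ⟶ X, R.complex.d (n + 2) (n + 1) ≫ x = 0 →
      ∃ y : R.complex.X n ⟶ X, R.complex.d (n + 1) n ≫ y = x) :
    Subsingleton (Ext (R.syz n) X.obj 1) := by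
  refine subsingleton_of_forall_eq 0 fun e => ?_
  obtain ⟨e₀, rfl⟩ := Ext.contravariant_sequence_exact₃ (R.shortExact n) X.obj e
    (Ext.eq_zero_of_projective (P := (R.term n).obj) _) (add_zero 1)
  obtain ⟨φ : R.syz (n + 1) ⟶ X.obj, rfl⟩ := Ext.mk₀_bijective _ _ |>.2 e₀
  obtain ⟨y, hy⟩ := h (ObjectProperty.homMk (R.π (n + 1) ≫ φ)) (by
    rw [complex_d]
    ext : 1
    change (R.π (n + 2) ≫ R.ι (n + 1)) ≫ R.π (n + 1) ≫ φ = 0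
    rw [Category.assoc, reassoc_of% R.zero, zero_comp, comp_zero])
  rw [complex_d] at hy
  let y' : (R.term n).obj ⟶ X.obj := y.hom
  have hy' : (R.π (n + 1) ≫ R.ι n) ≫ y' = R.π (n + 1) ≫ φ := congrArg (fun g => g.hom) hy
  rw [Category.assoc, cancel_epi] at hy'
  rw [← hy', ← Ext.mk₀_comp_mk₀]
  exact (R.shortExact n).extClass_comp_assoc _

/-- Dimension shifting: each step down the syzygies raises the Ext degree by one, because the terms
are projective. -/
lemma subsingleton_ext_of_syz (X : ModuleCat.{u} A) (n k : ℕ)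
    (h : Subsingleton (Ext (R.syz n) X (k + 1))) :
    Subsingleton (Ext (R.syz 0) X (n + k + 1)) := by
  induction n generalizing k with
  | zero => rwa [Nat.zero_add]
  | succ n ih =>
    rw [show n + 1 + k + 1 = n + (k + 1) + 1 by omega]
    refine ih (k + 1) (subsingleton_of_forall_eq 0 fun e => ?_)
    obtain ⟨e₀ : Ext (R.syz (n + 1)) X (k + 1), rfl⟩ :=
      Ext.contravariant_sequence_exact₃ (R.shortExact n) X e
        (Ext.eq_zero_of_projective (P := (R.term n).obj) _) (add_comm 1 (k + 1))
    rw [Subsingleton.elim e₀ 0]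
    exact Ext.comp_zero (R.shortExact n).extClass _ _ _ _

end SyzygySequence

/-- If the functor `β` of `proj A` is dense, then for every finitely generated module `M` and every
finitely generated projective module `X` some `Extⁿ⁺¹(M, X)` vanishes. -/
lemma exists_subsingleton_ext_of_essSurj [IsNoetherianRing A] [(beta (Proj A)).EssSurj]
    (M : ModuleCat.{u} A) (hM : Module.Finite A M) (X : Proj A) :
    ∃ n : ℕ, Subsingleton (Ext M X.obj (n + 1)) := by
  obtain ⟨R, rfl⟩ := exists_syzygySequence M hM
  obtain ⟨n, hn⟩ := exists_chain_cocycle_factors_of_essSurj _ R.complex_exact X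
  exact ⟨n, R.subsingleton_ext_of_syz X.obj n 0 (R.subsingleton_ext_one_syz X n (hn n le_rfl))⟩

end Resolution

end StableDerived

/-- If `A` is a left Artin ring and the functor `β` from the totally acyclic complexes over `proj A`
to the stable derived category of `A` is dense, then `A` has finite injective dimension as a left
module over itself. -/
theorem corollary2p4 (A : Type u) [Ring A] [IsArtinianRing A]
    (hβ : (StableDerived.beta (StableDerived.Proj A)).EssSurj) :
    CategoryTheory.injectiveDimension (ModuleCat.of A A) ≠ ⊤ := by
  rw [CategoryTheory.injectiveDimension_ne_top_iff]
  -- The degree found depends on the module, so the argument is run once, with `A ⧸ J` against `A`.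
  -- The left Noetherian hypothesis is automatic for a left Artinian ring.
  obtain ⟨n, hn⟩ := StableDerived.exists_subsingleton_ext_of_essSurj
    (ModuleCat.of A (A ⧸ Ring.jacobson A)) (inferInstanceAs (Module.Finite A (A ⧸ Ring.jacobson A)))
    ⟨ModuleCat.of A A, inferInstanceAs (Module.Finite A A), inferInstanceAs (Module.Projective A A)⟩
  exact ⟨n, StableDerived.hasInjectiveDimensionLE_of_jacobson_quotient _ n hn⟩
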